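/- Let $k\ge 1$, let $\mathcal P_k$ be the $(k+1)$-dimensional space of complex polynomials in $z$ of degree at most $k$, and let $U\subset\mathcal P_k$ be a subspace of dimension $k$ (codimension $1$). For a basis $p_1,\dots,p_k$ of $U$ let $W(p_1,\dots,p_k)=\det\bigl(p_i^{(j-1)}\bigr)_{1\le i,j\le k}$ be its Wronskian, and let $W(U)$ be the span of $W(p_1,\dots,p_k)$. Then $W(U)$ is a one-dimensional subspace of $\mathcal P_k$ that does not depend on the basis; we also write $W(U)$ for a nonzero element of it, which is a polynomial of degree at most $k$ defined up to a nonzero scalar. Its order of vanishing at $\infty$ is $k-\deg W(U)$, so that $\infty$ is a root of $W(U)$ if and only if $\deg W(U)<k$. Let $m$ be the number of distinct roots of $W(U)$ in $\mathbb C\cup\{\infty\}$; then $1\le m\le k$. A top power is a polynomial of the form $(az+b)^k$ with $a,b\in\mathbb C$, $(a,b)\neq(0,0)$. Then, up to nonzero scalar multiples, $U$ contains exactly $m$ top powers. In particular, $U$ has a basis consisting of top powers if and only if all roots of $W(U)$ in $\mathbb C$ are simple and $k-1\le\deg W(U)\le k$. -/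

import Mathlib

open Polynomial

noncomputable section

/-- The Grassmannian of `k`-dimensional subspaces of the space `P_n` of complex polynomials of
degree at most `n`. -/
def polyGrassmannian (k n : ℕ) : Set (Submodule ℂ ℂ[X]) :=
  {U | U ≤ Polynomial.degreeLE ℂ (n : WithBot ℕ) ∧ Module.finrank ℂ U = k}

/-- The Wronskian determinant of `k` polynomials: row `i` is `p i, (p i)', …, (p i)^(k-1)`. -/
def polyWronskian {k : ℕ} (p : Fin k → ℂ[X]) : ℂ[X] :=
  (Matrix.of fun i j : Fin k => derivative^[(j : ℕ)] (p i)).det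

/-- The Wronskian covariant `W(U)` of a `k`-dimensional polynomial subspace `U`: the span of
the Wronskian of a basis of `U`. All bases are taken at once; their Wronskians are
proportional. -/
def wronskianCovariant (k : ℕ) (U : Submodule ℂ ℂ[X]) : Submodule ℂ ℂ[X] :=
  Submodule.span ℂ (Set.range fun p : Module.Basis (Fin k) ℂ U =>
    polyWronskian fun i => (p i : ℂ[X]))

/-- The order of vanishing at a point of the extended complex plane of a nonzero polynomial `q`
of degree at most `n`, regarded as an element of `P_n`: the multiplicity of the root at a finite
point, and `n - deg q` at `∞`. -/
def projOrd (n : ℕ) (q : ℂ[X]) (x : OnePoint ℂ) : ℕ :=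
  x.elim (n - q.natDegree) (fun z => q.rootMultiplicity z)

/-- The set of distinct roots, counting `∞`, of a nonzero element `q` of `P_n`. -/
def projRoots (n : ℕ) (q : ℂ[X]) : Set (OnePoint ℂ) :=
  {x | 0 < projOrd n q x}

/-- A top power in `P_n`: a polynomial `(a z + b) ^ n` with `(a, b) ≠ (0, 0)`. -/
def IsTopPower (n : ℕ) (p : ℂ[X]) : Prop :=
  ∃ a b : ℂ, (a, b) ≠ (0, 0) ∧ p = (C a * X + C b) ^ n

/-- The top powers of `P_n` contained in `U`, up to nonzero scalar multiples: the lines spanned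
by the top powers that lie in `U`. -/
def topPowerLines (n : ℕ) (U : Submodule ℂ ℂ[X]) : Set (Submodule ℂ ℂ[X]) :=
  {L | ∃ p ∈ U, IsTopPower n p ∧ L = Submodule.span ℂ {p}}

/-- The `k`-dimensional subspace `U` of `P_n` has a basis of top powers. -/
def HasTopPowerBasis (k n : ℕ) (U : Submodule ℂ ℂ[X]) : Prop :=
  ∃ p : Module.Basis (Fin k) ℂ U, ∀ i, IsTopPower n (p i : ℂ[X])

end

/-! A hyperplane `U` of `P_k` is the kernel of a functional `L`, namely the coefficient determinant
of a basis of `U` followed by a variable polynomial. Taking `(X - z) ^ k` as that polynomial and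
passing from coefficients to derivatives at `z` turns the determinant into a nonzero constant times
the Wronskian at `z` (`factorial_mul_eval_polyWronskian`). Hence `W(U)(z)` is `L ((X - z) ^ k)` up
to scale, and its coefficient of `z ^ k` is `± L 1`: roots in `ℂ ∪ {∞}` correspond exactly to top
powers in `U` (`mem_projRoots_iff_topPower_mem`). Any `k` distinct top powers are independent, by a
projective Vandermonde determinant, so a basis of them exists iff there are at least `k` distinct
roots. -/

/-! ### The Wronskian as a coefficient determinant -/

/-- The first `k + 1` coefficients of a polynomial. -/
noncomputable def coeffVec (k : ℕ) : ℂ[X] →ₗ[ℂ] (Fin (k + 1) → ℂ) :=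
  LinearMap.pi fun j => lcoeff ℂ (j : ℕ)

@[simp] theorem coeffVec_apply (k : ℕ) (f : ℂ[X]) (j : Fin (k + 1)) :
    coeffVec k f j = f.coeff j := rfl

theorem coeffVec_injOn (k : ℕ) :
    Set.InjOn (coeffVec k) (degreeLE ℂ (k : WithBot ℕ) : Set ℂ[X]) := by
  intro f hf g hg h
  ext m
  by_cases hm : m < k + 1
  · exact congrFun h ⟨m, hm⟩
  · have hf' := natDegree_le_of_degree_le (mem_degreeLE.1 hf)
    have hg' := natDegree_le_of_degree_le (mem_degreeLE.1 hg)
    rw [coeff_eq_zero_of_natDegree_lt (by omega), coeff_eq_zero_of_natDegree_lt (by omega)]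

/-- The values at `z` of the iterated derivatives of the monomials. -/
noncomputable def derivMatrix (n : ℕ) (z : ℂ) : Matrix (Fin n) (Fin n) ℂ :=
  Matrix.of fun m j => (derivative^[(j : ℕ)] (X ^ (m : ℕ) : ℂ[X])).eval z

/-- Differentiating `X ^ m` more than `m` times gives zero, so the matrix is triangular and its
determinant does not depend on `z`. -/
theorem det_derivMatrix (n : ℕ) (z : ℂ) :
    (derivMatrix n z).det = ∏ m : Fin n, ((m : ℕ).factorial : ℂ) := by
  rw [Matrix.det_of_isLowerTriangular]
  · refine Finset.prod_congr rfl fun m _ => ?_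
    simp [derivMatrix, iterate_derivative_X_pow_eq_natCast_mul, Nat.descFactorial_self]
  · intro i j hij
    have hij : i < j := hij
    simp only [derivMatrix, Matrix.of_apply]
    rw [iterate_derivative_eq_zero (by simpa using hij), eval_zero]

theorem eval_iterate_derivative_eq_sum {k : ℕ} {f : ℂ[X]}
    (hf : f ∈ degreeLE ℂ (k : WithBot ℕ)) (z : ℂ) (j : Fin (k + 1)) :
    (derivative^[(j : ℕ)] f).eval z = ∑ m, coeffVec k f m * derivMatrix (k + 1) z m j := by
  have hf' := natDegree_le_of_degree_le (mem_degreeLE.1 hf)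
  conv_lhs => rw [f.as_sum_range_C_mul_X_pow' (n := k + 1) (by omega)]
  rw [iterate_derivative_sum, eval_finsetSum,
    Finset.sum_range fun m => (derivative^[(j : ℕ)] (C (f.coeff m) * X ^ m)).eval z]
  simp [derivMatrix, iterate_derivative_C_mul]

/-- The determinant of the first `k + 1` coefficients of `p` and `f`, as a functional of `f`. -/
noncomputable def snocDet {k : ℕ} (p : Fin k → ℂ[X]) : ℂ[X] →ₗ[ℂ] ℂ :=
  (Matrix.detRowAlternating.toMultilinearMap.toLinearMap
    (Fin.snoc (fun i => coeffVec k (p i)) 0 : Fin (k + 1) → Fin (k + 1) → ℂ) (Fin.last k)) ∘ₗ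
    coeffVec k

theorem snocDet_apply {k : ℕ} (p : Fin k → ℂ[X]) (f : ℂ[X]) :
    snocDet p f = (Matrix.of fun i : Fin (k + 1) =>
      coeffVec k ((Fin.snoc p f : Fin (k + 1) → ℂ[X]) i)).det := by
  simp only [snocDet, LinearMap.comp_apply, MultilinearMap.toLinearMap_apply, Fin.update_snoc_last]
  change Matrix.det _ = _
  congr 1
  ext i j
  refine Fin.lastCases ?_ (fun i => ?_) i <;> simp

theorem snocDet_eq_zero_iff {k : ℕ} {p : Fin k → ℂ[X]} (hp : LinearIndependent ℂ p)
    (hdeg : ∀ i, p i ∈ degreeLE ℂ (k : WithBot ℕ)) {f : ℂ[X]}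
    (hf : f ∈ degreeLE ℂ (k : WithBot ℕ)) :
    snocDet p f = 0 ↔ f ∈ Submodule.span ℂ (Set.range p) := by
  have hle : Submodule.span ℂ (Set.range (Fin.snoc p f : Fin (k + 1) → ℂ[X])) ≤
      degreeLE ℂ (k : WithBot ℕ) := by
    rw [Submodule.span_le]
    rintro _ ⟨i, rfl⟩
    refine Fin.lastCases ?_ (fun i => ?_) i
    · simpa using hf
    · simpa using hdeg i
  have h1 := (coeffVec k).linearIndependent_iff_of_injOn
    (v := (Fin.snoc p f : Fin (k + 1) → ℂ[X])) ((coeffVec_injOn k).mono hle)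
  rw [linearIndependent_finSnoc] at h1
  have h2 := Matrix.linearIndependent_rows_iff_isUnit (A := Matrix.of fun i : Fin (k + 1) =>
      coeffVec k ((Fin.snoc p f : Fin (k + 1) → ℂ[X]) i))
  rw [Matrix.isUnit_iff_isUnit_det, isUnit_iff_ne_zero, ← snocDet_apply] at h2
  have h3 := h2.symm.trans h1
  tauto

theorem X_sub_C_pow_mem_degreeLE (k : ℕ) (z : ℂ) :
    (X - C z) ^ k ∈ degreeLE ℂ (k : WithBot ℕ) := by
  rw [mem_degreeLE, degree_pow, degree_X_sub_C]
  simp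

theorem factorial_mul_eval_polyWronskian {k : ℕ} {p : Fin k → ℂ[X]}
    (hdeg : ∀ i, p i ∈ degreeLE ℂ (k : WithBot ℕ)) (z : ℂ) :
    (k.factorial : ℂ) * (polyWronskian p).eval z =
      snocDet p ((X - C z) ^ k) * ∏ m : Fin (k + 1), ((m : ℕ).factorial : ℂ) := by
  rw [snocDet_apply, ← det_derivMatrix (k + 1) z, ← Matrix.det_mul]
  have hmul : ((Matrix.of fun i : Fin (k + 1) =>
      coeffVec k ((Fin.snoc p ((X - C z) ^ k) : Fin (k + 1) → ℂ[X]) i)) *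
      derivMatrix (k + 1) z) = Matrix.of fun i j : Fin (k + 1) =>
      (derivative^[(j : ℕ)] ((Fin.snoc p ((X - C z) ^ k) : Fin (k + 1) → ℂ[X]) i)).eval z := by
    ext i j
    rw [Matrix.mul_apply, Matrix.of_apply, eval_iterate_derivative_eq_sum (k := k)]
    · rfl
    · refine Fin.lastCases ?_ (fun i => ?_) i
      · simpa using X_sub_C_pow_mem_degreeLE k z
      · simpa using hdeg i
  -- At `z` every derivative of `(X - z) ^ k` of order below `k` vanishes and the `k`-th is `k!`, so
  -- the last row has a single nonzero entry, with sign `(-1) ^ (k + k)`.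
  rw [hmul, Matrix.det_succ_row _ (Fin.last k), Finset.sum_eq_single (Fin.last k)]
  · rw [polyWronskian, ← coe_evalRingHom, RingHom.map_det]
    simp only [Matrix.of_apply, Fin.snoc_last, Fin.val_last, iterate_derivative_X_sub_pow_self,
      ← two_mul, pow_mul, neg_one_sq, one_pow, one_mul]
    congr 1
    · simp
    · congr 1
      ext i j
      simp
  · intro j _ hj
    have hj' : k - (j : ℕ) ≠ 0 := by
      have := Fin.val_lt_last hj
      omega
    simp [iterate_derivative_X_sub_pow, hj']
  · simp

/-! ### Functionals on top powers and the Wronskian line -/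

/-- The polynomial whose value at `z` is `L ((X - z) ^ k)`. -/
noncomputable def topPowerForm (k : ℕ) (L : ℂ[X] →ₗ[ℂ] ℂ) : ℂ[X] :=
  ∑ m ∈ Finset.range (k + 1), monomial m ((-1) ^ m * k.choose m * L (X ^ (k - m)))

theorem coeff_topPowerForm {k m : ℕ} (L : ℂ[X] →ₗ[ℂ] ℂ) (hm : m ≤ k) :
    (topPowerForm k L).coeff m = (-1) ^ m * k.choose m * L (X ^ (k - m)) := by
  simp [topPowerForm, coeff_monomial, Nat.lt_succ_iff.2 hm]

theorem natDegree_topPowerForm_le (k : ℕ) (L : ℂ[X] →ₗ[ℂ] ℂ) :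
    (topPowerForm k L).natDegree ≤ k :=
  natDegree_sum_le_of_forall_le _ _ fun _ hm =>
    (natDegree_monomial_le _).trans (Nat.lt_succ_iff.1 (Finset.mem_range.1 hm))

theorem eval_topPowerForm (k : ℕ) (L : ℂ[X] →ₗ[ℂ] ℂ) (z : ℂ) :
    (topPowerForm k L).eval z = L ((X - C z) ^ k) := by
  symm
  rw [sub_eq_neg_add, add_pow, map_sum, topPowerForm, eval_finsetSum]
  refine Finset.sum_congr rfl fun m _ => ?_
  have : (-C z) ^ m * X ^ (k - m) * ((k.choose m : ℕ) : ℂ[X]) =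
      ((-1) ^ m * z ^ m * k.choose m : ℂ) • X ^ (k - m) := by
    rw [smul_eq_C_mul]
    simp only [C_mul, C_pow, C_neg, C_1, neg_pow (C z), map_natCast]
    ring
  rw [this, map_smul, eval_monomial, smul_eq_mul]
  ring

/-- The Wronskian of a basis of a codimension one subspace is a linear functional with that kernel,
evaluated on the powers `(X - z) ^ k`. -/
theorem exists_functional {k : ℕ} {U : Submodule ℂ ℂ[X]} (hU : U ∈ polyGrassmannian k k)
    (p : Module.Basis (Fin k) ℂ U) :
    ∃ L : ℂ[X] →ₗ[ℂ] ℂ, (∀ f ∈ degreeLE ℂ (k : WithBot ℕ), L f = 0 ↔ f ∈ U) ∧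
      polyWronskian (fun i => (p i : ℂ[X])) = topPowerForm k L := by
  have hdeg : ∀ i, (p i : ℂ[X]) ∈ degreeLE ℂ (k : WithBot ℕ) := fun i => hU.1 (p i).2
  have hli : LinearIndependent ℂ fun i => (p i : ℂ[X]) :=
    p.linearIndependent.map' U.subtype U.ker_subtype
  have hspan : Submodule.span ℂ (Set.range fun i => (p i : ℂ[X])) = U := by
    have : (Set.range fun i => (p i : ℂ[X])) = U.subtype '' Set.range p := by
      rw [← Set.range_comp]; rfl
    rw [this, Submodule.span_image, p.span_eq, Submodule.map_top, Submodule.range_subtype]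
  have hk : (k.factorial : ℂ) ≠ 0 := Nat.cast_ne_zero.2 k.factorial_ne_zero
  have hc : (∏ m : Fin (k + 1), ((m : ℕ).factorial : ℂ)) ≠ 0 :=
    Finset.prod_ne_zero_iff.2 fun m _ => Nat.cast_ne_zero.2 (Nat.factorial_ne_zero _)
  refine ⟨((∏ m : Fin (k + 1), ((m : ℕ).factorial : ℂ)) / k.factorial) •
    snocDet fun i => (p i : ℂ[X]), fun f hf => ?_, ?_⟩
  · rw [LinearMap.smul_apply, smul_eq_mul, mul_eq_zero, or_iff_right (div_ne_zero hc hk),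
      snocDet_eq_zero_iff hli hdeg hf, hspan]
  · refine Polynomial.funext fun z => ?_
    rw [eval_topPowerForm, LinearMap.smul_apply, smul_eq_mul]
    have := factorial_mul_eval_polyWronskian hdeg z
    field_simp
    linear_combination this

/-- A change of basis has constant entries, so it commutes with differentiation and factors out of
the determinant. -/
theorem polyWronskian_basis_smul {k : ℕ} {U : Submodule ℂ ℂ[X]} (p q : Module.Basis (Fin k) ℂ U) :
    ∃ c : ℂ, polyWronskian (fun i => (q i : ℂ[X])) =
      c • polyWronskian (fun i => (p i : ℂ[X])) := by
  refine ⟨(p.toMatrix q).det, ?_⟩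
  have h : (Matrix.of fun i j : Fin k => derivative^[(j : ℕ)] (q i : ℂ[X])) =
      (p.toMatrix q).transpose.map C *
        Matrix.of fun i j : Fin k => derivative^[(j : ℕ)] (p i : ℂ[X]) := by
    ext1 i j
    have hq : (q i : ℂ[X]) = ∑ l, C (p.toMatrix q l i) * (p l : ℂ[X]) := by
      have := congrArg U.subtype (p.sum_toMatrix_smul_self q i)
      rw [map_sum] at this
      simp only [← smul_eq_C_mul]
      exact this.symm
    rw [Matrix.of_apply, hq, iterate_derivative_sum, Matrix.mul_apply]
    simp [iterate_derivative_C_mul]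
  rw [polyWronskian, h, Matrix.det_mul, smul_eq_C_mul, ← RingHom.mapMatrix_apply, ← RingHom.map_det,
    Matrix.det_transpose]
  rfl

theorem wronskianCovariant_eq_span {k : ℕ} {U : Submodule ℂ ℂ[X]}
    (p : Module.Basis (Fin k) ℂ U) :
    wronskianCovariant k U = Submodule.span ℂ {polyWronskian fun i => (p i : ℂ[X])} := by
  refine le_antisymm (Submodule.span_le.2 ?_) (Submodule.span_mono ?_)
  · rintro _ ⟨q, rfl⟩
    obtain ⟨c, hc⟩ := polyWronskian_basis_smul p q
    exact Submodule.mem_span_singleton.2 ⟨c, hc.symm⟩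
  · rintro _ rfl
    exact ⟨p, rfl⟩

/-! ### Top powers as points of the extended plane -/

/-- The top power vanishing at a point of the extended complex plane. -/
noncomputable def topPower (k : ℕ) (x : OnePoint ℂ) : ℂ[X] :=
  x.elim 1 fun z => (X - C z) ^ k

@[simp] theorem topPower_infty (k : ℕ) : topPower k OnePoint.infty = 1 := rfl

@[simp] theorem topPower_coe (k : ℕ) (z : ℂ) : topPower k (z : OnePoint ℂ) = (X - C z) ^ k := rfl

theorem isTopPower_topPower (k : ℕ) (x : OnePoint ℂ) : IsTopPower k (topPower k x) := by
  induction x using OnePoint.rec with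
  | infty => exact ⟨0, 1, by simp, by simp⟩
  | coe z => exact ⟨1, -z, by simp, by simp [sub_eq_add_neg]⟩

theorem IsTopPower.exists_eq_smul {k : ℕ} {p : ℂ[X]} (hp : IsTopPower k p) :
    ∃ x : OnePoint ℂ, ∃ c : ℂ, c ≠ 0 ∧ p = c • topPower k x := by
  obtain ⟨a, b, hab, rfl⟩ := hp
  by_cases ha : a = 0
  · have hb : b ≠ 0 := by rintro rfl; simp [ha] at hab
    exact ⟨OnePoint.infty, b ^ k, pow_ne_zero _ hb, by simp [ha, smul_eq_C_mul]⟩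
  · refine ⟨((-b / a : ℂ) : OnePoint ℂ), a ^ k, pow_ne_zero _ ha, ?_⟩
    rw [topPower_coe, smul_eq_C_mul, C_pow, ← mul_pow, mul_sub, ← C_mul]
    congr 1
    rw [show a * (-b / a) = -b by field_simp, C_neg, sub_neg_eq_add]

theorem span_topPower_injective {k : ℕ} (hk : 1 ≤ k) :
    Function.Injective fun x => Submodule.span ℂ {topPower k x} := by
  have hk0 : k ≠ 0 := by omega
  -- Evaluation at `w` detects only a finite point, so below the inclusion used is the one whose
  -- right side comes from a finite point.
  have key : ∀ (x : OnePoint ℂ) (w : ℂ),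
      topPower k x ∈ Submodule.span ℂ {topPower k (w : OnePoint ℂ)} → x = w := by
    intro x w h
    obtain ⟨c, hc⟩ := Submodule.mem_span_singleton.1 h
    have h0 := congrArg (eval w) hc
    induction x using OnePoint.rec with
    | infty => simp [hk0] at h0
    | coe z => simpa [hk0, sub_eq_zero, eq_comm] using h0
  intro x y h
  dsimp only at h
  have hx : topPower k x ∈ Submodule.span ℂ {topPower k y} := by
    rw [← h]; exact Submodule.mem_span_singleton_self _
  have hy : topPower k y ∈ Submodule.span ℂ {topPower k x} := by
    rw [h]; exact Submodule.mem_span_singleton_self _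
  induction y using OnePoint.rec with
  | coe w => exact key x w hx
  | infty =>
    induction x using OnePoint.rec with
    | coe z => exact (key _ z hy).symm
    | infty => rfl

theorem topPowerLines_eq_image (k : ℕ) (U : Submodule ℂ ℂ[X]) :
    topPowerLines k U =
      (fun x => Submodule.span ℂ {topPower k x}) '' {x | topPower k x ∈ U} := by
  ext L
  constructor
  · rintro ⟨p, hpU, hp, rfl⟩
    obtain ⟨x, c, hc, rfl⟩ := hp.exists_eq_smul
    exact ⟨x, (U.smul_mem_iff hc).1 hpU, (Submodule.span_singleton_smul_eq hc.isUnit _).symm⟩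
  · rintro ⟨x, hx, rfl⟩
    exact ⟨_, hx, isTopPower_topPower k x, rfl⟩

/-- In homogeneous coordinates `(v, w)`, the coefficients of `(v X + w) ^ k` are the entries of a
projective Vandermonde row times binomial coefficients. These are nonzero, so the rescaling `Ψ` is
injective and preserves independence of the rows. -/
theorem linearIndependent_topPower_succ {k : ℕ} {e : Fin (k + 1) → OnePoint ℂ}
    (he : Function.Injective e) : LinearIndependent ℂ fun i => topPower k (e i) := by
  set v : Fin (k + 1) → ℂ := fun i => (e i).elim 0 fun _ => 1 with hv
  set w : Fin (k + 1) → ℂ := fun i => (e i).elim 1 fun z => -z with hw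
  have hdet : (Matrix.projVandermonde v w).det ≠ 0 := by
    rw [Matrix.det_projVandermonde]
    refine Finset.prod_ne_zero_iff.2 fun i _ => Finset.prod_ne_zero_iff.2 fun j hj => ?_
    have hij : e i ≠ e j := he.ne (Finset.mem_Ioi.1 hj).ne
    simp only [hv, hw]
    generalize e i = x at hij
    generalize e j = y at hij
    induction x using OnePoint.rec with
    | infty =>
      induction y using OnePoint.rec with
      | infty => exact absurd rfl hij
      | coe w => simp
    | coe z =>
      induction y using OnePoint.rec with
      | infty => simp
      | coe w =>
        simp only [OnePoint.elim_some, one_mul, ne_eq]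
        intro h
        exact hij (congrArg _ (by linear_combination -h))
  have hrows : LinearIndependent ℂ (Matrix.projVandermonde v w).row := by
    rwa [Matrix.linearIndependent_rows_iff_isUnit, Matrix.isUnit_iff_isUnit_det,
      isUnit_iff_ne_zero]
  let Ψ : (Fin (k + 1) → ℂ) →ₗ[ℂ] ℂ[X] :=
    ∑ m : Fin (k + 1), (monomial (m : ℕ)) ∘ₗ ((k.choose m : ℂ) • LinearMap.proj m)
  have hΨsum : ∀ c, Ψ c = ∑ m : Fin (k + 1), C (k.choose m * c m) * X ^ (m : ℕ) := by
    intro c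
    simp [Ψ, C_mul_X_pow_eq_monomial, -map_mul]
  have hΨ : ∀ c (m : Fin (k + 1)), (Ψ c).coeff m = k.choose m * c m := by
    intro c m
    simp only [Ψ, LinearMap.sum_apply, LinearMap.comp_apply, finsetSum_coeff, coeff_monomial,
      LinearMap.smul_apply, LinearMap.proj_apply, smul_eq_mul, Fin.val_inj]
    simp
  have hker : LinearMap.ker Ψ = ⊥ := by
    rw [LinearMap.ker_eq_bot']
    intro c hc
    ext m
    have h := hΨ c m
    rw [hc, coeff_zero] at h
    exact (mul_eq_zero.1 h.symm).resolve_left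
      (Nat.cast_ne_zero.2 (Nat.choose_pos (Nat.lt_succ_iff.1 m.2)).ne')
  have hrowsΨ := hrows.map' Ψ hker
  suffices h : (fun i => topPower k (e i)) = Ψ ∘ (Matrix.projVandermonde v w).row by rwa [h]
  funext i
  have hpow : topPower k (e i) = (C (v i) * X + C (w i)) ^ k := by
    simp only [hv, hw]
    induction e i using OnePoint.rec with
    | infty => simp
    | coe z => simp [sub_eq_add_neg]
  rw [hpow, add_pow, Finset.sum_range]
  rw [Function.comp_apply, hΨsum]
  refine Finset.sum_congr rfl fun m _ => ?_
  have : (m.rev : ℕ) = k - m := by rw [Fin.val_rev]; omega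
  simp only [Matrix.row, Matrix.projVandermonde_apply, this, C_mul, C_pow, mul_pow, map_natCast]
  ring

theorem linearIndependent_topPower {k : ℕ} {e : Fin k → OnePoint ℂ}
    (he : Function.Injective e) : LinearIndependent ℂ fun i => topPower k (e i) := by
  -- An extra point outside the range reduces `k` points to the square case of `k + 1`.
  obtain ⟨x, hx⟩ := (Set.finite_range e).exists_notMem
  have h := linearIndependent_topPower_succ (e := Fin.cons x e) (Fin.cons_injective_iff.2 ⟨hx, he⟩)
  exact h.comp Fin.succ (Fin.succ_injective k)

theorem hasTopPowerBasis_iff_le_encard {k : ℕ} (hk : 1 ≤ k) {U : Submodule ℂ ℂ[X]}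
    (hU : Module.finrank ℂ U = k) :
    HasTopPowerBasis k k U ↔ (k : ℕ∞) ≤ {x | topPower k x ∈ U}.encard := by
  constructor
  · rintro ⟨p, hp⟩
    choose x c hc hpx using fun i => (hp i).exists_eq_smul
    have hx : Function.Injective x := by
      intro i j hij
      by_contra hne
      -- Two basis vectors attached to the same point would be proportional.
      have h : c j • p i - c i • p j = 0 := by
        apply Subtype.ext
        simp only [Submodule.coe_sub, Submodule.coe_smul, hpx, hij, smul_smul, mul_comm,
          sub_self, Submodule.coe_zero]
      have h' := congrArg (fun u => p.repr u i) h
      simp [Finsupp.single_eq_of_ne hne, hc] at h'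
    have hrange : Set.range x ⊆ {x | topPower k x ∈ U} := by
      rintro _ ⟨i, rfl⟩
      have := (p i).2
      rw [hpx] at this
      exact (U.smul_mem_iff (hc i)).1 this
    calc (k : ℕ∞) = (Set.range x).encard := by
          rw [← Set.image_univ, hx.encard_image]; simp
      _ ≤ _ := Set.encard_le_encard hrange
  · intro h
    obtain ⟨t, hts, ht⟩ := Set.exists_subset_encard_eq h
    have htfin : t.Finite := Set.finite_of_encard_eq_coe ht
    have hcard : htfin.toFinset.card = k := by
      rw [htfin.encard_eq_coe_toFinset_card] at ht
      exact_mod_cast ht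
    let e := htfin.toFinset.equivFinOfCardEq hcard
    have he : Function.Injective fun i => ((e.symm i : htfin.toFinset) : OnePoint ℂ) :=
      Subtype.val_injective.comp e.symm.injective
    have hmem : ∀ i, topPower k (e.symm i : htfin.toFinset) ∈ U := fun i =>
      hts (htfin.mem_toFinset.1 (e.symm i).2)
    have hli : LinearIndependent ℂ fun i => (⟨_, hmem i⟩ : U) :=
      LinearIndependent.of_comp U.subtype (linearIndependent_topPower he)
    have : Nonempty (Fin k) := ⟨⟨0, hk⟩⟩
    refine ⟨basisOfLinearIndependentOfCardEqFinrank hli (by simp [hU]), fun i => ?_⟩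
    rw [coe_basisOfLinearIndependentOfCardEqFinrank]
    exact isTopPower_topPower k _

/-! ### Counting roots, including infinity -/

theorem mem_projRoots_coe {n : ℕ} {q : ℂ[X]} (hq : q ≠ 0) (z : ℂ) :
    (z : OnePoint ℂ) ∈ projRoots n q ↔ q.IsRoot z :=
  rootMultiplicity_pos hq

theorem infty_mem_projRoots {n : ℕ} {q : ℂ[X]} :
    OnePoint.infty ∈ projRoots n q ↔ q.natDegree < n :=
  Nat.sub_pos_iff_lt

theorem projRoots_eq {n : ℕ} {q : ℂ[X]} (hq : q ≠ 0) :
    projRoots n q = (↑) '' (q.roots.toFinset : Set ℂ) ∪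
      if q.natDegree < n then {OnePoint.infty} else ∅ := by
  ext x
  induction x using OnePoint.rec with
  | infty =>
    rw [infty_mem_projRoots]
    split_ifs with h <;> simp [h]
  | coe z =>
    rw [mem_projRoots_coe hq]
    split_ifs with h <;> simp [hq]

theorem projRoots_finite {n : ℕ} {q : ℂ[X]} (hq : q ≠ 0) : (projRoots n q).Finite := by
  rw [projRoots_eq hq]
  refine ((Finset.finite_toSet _).image _).union ?_
  split_ifs <;> simp

theorem ncard_projRoots {n : ℕ} {q : ℂ[X]} (hq : q ≠ 0) :
    (projRoots n q).ncard = q.roots.toFinset.card + if q.natDegree < n then 1 else 0 := by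
  rw [projRoots_eq hq, Set.ncard_union_eq ?_ ((Finset.finite_toSet _).image _)
    (by split_ifs <;> simp)]
  · rw [Set.ncard_image_of_injective _ OnePoint.coe_injective, Set.ncard_coe_finset]
    split_ifs <;> simp
  · split_ifs <;> simp

theorem card_roots_toFinset_eq_natDegree_iff {q : ℂ[X]} (hq : q ≠ 0) :
    q.roots.toFinset.card = q.natDegree ↔ ∀ z, q.IsRoot z → q.rootMultiplicity z = 1 := by
  rw [← IsAlgClosed.card_roots_eq_natDegree, Multiset.toFinset_card_eq_card_iff_nodup,
    Multiset.nodup_iff_count_le_one]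
  refine forall_congr' fun z => ?_
  rw [count_roots]
  constructor
  · intro h hz
    have := (rootMultiplicity_pos hq).2 hz
    omega
  · intro h
    by_cases hz : q.IsRoot z
    · exact (h hz).le
    · simp [rootMultiplicity_eq_zero hz]

/-! ### Roots of the Wronskian versus top powers in `U` -/

/-- If all coefficients vanished, `L` would kill every monomial of degree at most `k`, forcing `U`
to be all of `P_k`, of dimension `k + 1`. -/
theorem topPowerForm_ne_zero {k : ℕ} {U : Submodule ℂ ℂ[X]} (hU : U ∈ polyGrassmannian k k)
    {L : ℂ[X] →ₗ[ℂ] ℂ} (hL : ∀ f ∈ degreeLE ℂ (k : WithBot ℕ), L f = 0 ↔ f ∈ U) :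
    topPowerForm k L ≠ 0 := by
  intro h
  have hmem : ∀ m ≤ k, (X ^ m : ℂ[X]) ∈ U := by
    intro m hm
    have hco := coeff_topPowerForm L (Nat.sub_le k m)
    rw [h, coeff_zero, Nat.sub_sub_self hm, eq_comm, mul_eq_zero, or_iff_right] at hco
    · exact (hL _ (by simpa [mem_degreeLE] using hm)).1 hco
    · exact mul_ne_zero (pow_ne_zero _ (by simp))
        (Nat.cast_ne_zero.2 (Nat.choose_pos (Nat.sub_le k m)).ne')
  have hUeq : U = degreeLT ℂ (k + 1) := by
    refine le_antisymm (hU.1.trans ?_) ?_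
    · intro f hf
      rw [mem_degreeLE] at hf
      exact mem_degreeLT.2 (hf.trans_lt (by exact_mod_cast k.lt_succ_self))
    · rw [degreeLT_eq_span_X_pow, Submodule.span_le]
      intro f hf
      obtain ⟨m, hm, rfl⟩ := Finset.mem_image.1 (Finset.mem_coe.1 hf)
      exact hmem m (Nat.lt_succ_iff.1 (Finset.mem_range.1 hm))
  have hrank := (degreeLTEquiv ℂ (k + 1)).finrank_eq
  rw [← hUeq, hU.2, Module.finrank_fin_fun] at hrank
  omega

theorem mem_projRoots_iff_topPower_mem {k : ℕ} {U : Submodule ℂ ℂ[X]} {L : ℂ[X] →ₗ[ℂ] ℂ}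
    (hL : ∀ f ∈ degreeLE ℂ (k : WithBot ℕ), L f = 0 ↔ f ∈ U) {q : ℂ[X]} (hq : q ≠ 0)
    {a : ℂ} (hqL : q = a • topPowerForm k L) (x : OnePoint ℂ) :
    x ∈ projRoots k q ↔ topPower k x ∈ U := by
  have ha : a ≠ 0 := by rintro rfl; simp at hqL; exact hq hqL
  induction x using OnePoint.rec with
  | infty =>
    have hdeg : q.natDegree ≤ k := by
      rw [hqL]
      exact (natDegree_smul_le _ _).trans (natDegree_topPowerForm_le k L)
    have hco : q.coeff k = a * ((-1) ^ k * L 1) := by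
      simp [hqL, coeff_topPowerForm]
    have h1 : q.coeff k = 0 ↔ q.natDegree < k := by
      constructor
      · intro h
        refine lt_of_le_of_ne hdeg ?_
        rintro rfl
        exact hq (leadingCoeff_eq_zero.1 h)
      · exact coeff_eq_zero_of_natDegree_lt
    rw [infty_mem_projRoots, ← h1, hco, topPower_infty, ← hL 1 (by simp [mem_degreeLE])]
    simp [ha]
  | coe z =>
    rw [mem_projRoots_coe hq, topPower_coe, ← hL _ (X_sub_C_pow_mem_degreeLE k z),
      ← eval_topPowerForm, IsRoot.def, hqL, eval_smul, smul_eq_mul, mul_eq_zero,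
      or_iff_right ha]

/-- For a codimension one subspace `U` of `P_k`, the Wronskian covariant `W(U)` is a line in
`P_k`; `q` is any nonzero polynomial on it. -/
theorem proposition5p12 (k : ℕ) (hk : 1 ≤ k) (U : Submodule ℂ ℂ[X])
    (hU : U ∈ polyGrassmannian k k) :
    wronskianCovariant k U ∈ polyGrassmannian 1 k ∧
    ∀ q ∈ wronskianCovariant k U, q ≠ 0 →
      (projRoots k q).Finite ∧
      1 ≤ (projRoots k q).ncard ∧ (projRoots k q).ncard ≤ k ∧
      (topPowerLines k U).encard = ((projRoots k q).ncard : ℕ∞) ∧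
      (HasTopPowerBasis k k U ↔
        (∀ z : ℂ, q.IsRoot z → q.rootMultiplicity z = 1) ∧
          k - 1 ≤ q.natDegree ∧ q.natDegree ≤ k) := by
  have : FiniteDimensional ℂ U := FiniteDimensional.of_finrank_pos (by rw [hU.2]; omega)
  obtain ⟨L, hL, hW⟩ := exists_functional hU (Module.finBasisOfFinrankEq ℂ U hU.2)
  rw [wronskianCovariant_eq_span (Module.finBasisOfFinrankEq ℂ U hU.2), hW]
  refine ⟨⟨?_, finrank_span_singleton (topPowerForm_ne_zero hU hL)⟩, fun q hqW hq => ?_⟩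
  · rw [Submodule.span_singleton_le_iff_mem, mem_degreeLE]
    exact degree_le_of_natDegree_le (natDegree_topPowerForm_le k L)
  obtain ⟨a, haq⟩ := Submodule.mem_span_singleton.1 hqW
  have hdeg : q.natDegree ≤ k := by
    rw [← haq]
    exact (natDegree_smul_le _ _).trans (natDegree_topPowerForm_le k L)
  have hroots : {x | topPower k x ∈ U} = projRoots k q :=
    Set.ext fun x => (mem_projRoots_iff_topPower_mem hL hq haq.symm x).symm
  have hfin : (projRoots k q).Finite := projRoots_finite hq
  have hcard := ncard_projRoots (n := k) hq
  have hle : q.roots.toFinset.card ≤ q.natDegree :=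
    q.roots.toFinset_card_le.trans q.card_roots'
  refine ⟨hfin, ?_, ?_, ?_, ?_⟩
  · rw [hcard]
    split_ifs with h
    · omega
    · obtain ⟨z, hz⟩ := IsAlgClosed.exists_root q
        (degree_ne_of_natDegree_ne (show q.natDegree ≠ 0 by omega))
      have : 0 < q.roots.toFinset.card := Finset.card_pos.2 ⟨z, by simp [hq, hz.eq_zero]⟩
      omega
  · rw [hcard]
    split_ifs with h <;> omega
  · rw [topPowerLines_eq_image, (span_topPower_injective hk).encard_image, hroots,
      hfin.cast_ncard_eq]
  · rw [hasTopPowerBasis_iff_le_encard hk hU.2, hroots, ← hfin.cast_ncard_eq, Nat.cast_le, hcard,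
      ← card_roots_toFinset_eq_natDegree_iff hq]
    -- With `r` distinct finite roots, `r ≤ deg q ≤ k`, and at most one extra root at `∞`, present
    -- iff `deg q < k`, reaching `k` roots forces `r = deg q` and `deg q ≥ k - 1`, and conversely.
    split_ifs with h <;> omega
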